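/- Let $\mathcal H_0,\mathcal H_1$ be complex Hilbert spaces, $\mathcal H=\mathcal H_0\oplus\mathcal H_1$ their orthogonal sum, $A_i$ ($i=0,1$) a possibly unbounded self-adjoint operator in $\mathcal H_i$ with domain $\operatorname{dom}(A_i)$, $B_{01}\colon\mathcal H_1\to\mathcal H_0$ a bounded operator, and $B_{10}=B_{01}^*$. Consider the operator $$\mathbf H=\begin{pmatrix}A_0&B_{01}\\ B_{10}&A_1\end{pmatrix},\qquad \operatorname{dom}(\mathbf H)=\operatorname{dom}(A_0)\oplus\operatorname{dom}(A_1).$$ Let $Q_{10}\colon\mathcal H_0\to\mathcal H_1$ be a bounded operator, let $Q_{01}=-Q_{10}^*$, and assume that the graph subspaces $$\mathcal G_0=\{(x_0,x_1):x_1=Q_{10}x_0\},\qquad \mathcal G_1=\{(x_0,x_1):x_0=Q_{01}x_1\}$$ reduce $\mathbf H$. (A closed subspace $\mathcal G$ reduces $\mathbf H$ if $\operatorname{dom}(\mathbf H)=(\operatorname{dom}(\mathbf H)\cap\mathcal G)\oplus(\operatorname{dom}(\mathbf H)\cap\mathcal G^\perp)$ and $\mathbf H$ maps $\operatorname{dom}(\mathbf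 H)\cap\mathcal G$ into $\mathcal G$ and $\operatorname{dom}(\mathbf H)\cap\mathcal G^\perp$ into $\mathcal G^\perp$.) Put $$\mathbf Q=\begin{pmatrix}0&Q_{01}\\ Q_{10}&0\end{pmatrix},\qquad \mathbf V=\mathbf I+\mathbf Q.$$ Products of operators are taken on their natural domains, and an equality of operators includes equality of their domains. Then: (i) $\mathbf V$ has a bounded inverse, defined on all of $\mathcal H$. (ii) $$\mathbf V^{-1}\mathbf H\mathbf V=\begin{pmatrix}A_0+B_{01}Q_{10}&0\\0&A_1+B_{10}Q_{01}\end{pmatrix},$$ where $\operatorname{dom}(A_i+B_{ij}Q_{ji})=\operatorname{dom}(A_i)$ for $i=0,1$, $j=1-i$. (iii) There is exactly one unitary operator $\mathbf U$ with $\mathbf V=\mathbf U|\mathbf V|$, where $|\mathbf V|=(\mathbf V^*\mathbf V)^{1/2}$, and for it $$\mathbf U^*\mathbf H\mathbf U=\begin{pmatrix}H_0&0\\0&H_1\end{pmatrix},$$ where, for $i=0,1$ and $j=1-i$, with $I$ the identity on $\mathcal H_i$, $$H_i=(I+Q_{ji}^*Q_{ji})^{1/2}(A_i+B_{ij}Q_{ji})(I+Q_{ji}^*Q_{ji})^{-1/2},\qquad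 \operatorname{dom}(H_i)=(I+Q_{ji}^*Q_{ji})^{1/2}\bigl(\operatorname{dom}(A_i)\bigr).$$ -/

import Mathlib

open scoped InnerProductSpace

/-- The orthogonal sum `H₀ ⊕ H₁` of two Hilbert spaces. -/
abbrev OrthSum (H₀ H₁ : Type*) := WithLp 2 (H₀ × H₁)

noncomputable section Blocks

variable {H₀ H₁ : Type*}
  [NormedAddCommGroup H₀] [InnerProductSpace ℂ H₀]
  [NormedAddCommGroup H₁] [InnerProductSpace ℂ H₁]

/-- The first component `H₀ ⊕ H₁ → H₀` as a bounded operator. -/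
def sumFst : OrthSum H₀ H₁ →L[ℂ] H₀ :=
  ContinuousLinearMap.fst ℂ H₀ H₁ ∘L
    (WithLp.prodContinuousLinearEquiv 2 ℂ H₀ H₁ : OrthSum H₀ H₁ →L[ℂ] H₀ × H₁)

/-- The second component `H₀ ⊕ H₁ → H₁` as a bounded operator. -/
def sumSnd : OrthSum H₀ H₁ →L[ℂ] H₁ :=
  ContinuousLinearMap.snd ℂ H₀ H₁ ∘L
    (WithLp.prodContinuousLinearEquiv 2 ℂ H₀ H₁ : OrthSum H₀ H₁ →L[ℂ] H₀ × H₁)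

/-- The bounded off-diagonal operator with block matrix `(0, C₀₁; C₁₀, 0)`,
that is, `(x₀, x₁) ↦ (C₀₁ x₁, C₁₀ x₀)`. -/
def offDiag (C₀₁ : H₁ →L[ℂ] H₀) (C₁₀ : H₀ →L[ℂ] H₁) :
    OrthSum H₀ H₁ →L[ℂ] OrthSum H₀ H₁ :=
  ((WithLp.prodContinuousLinearEquiv 2 ℂ H₀ H₁).symm : H₀ × H₁ →L[ℂ] OrthSum H₀ H₁) ∘L
    ((C₀₁ ∘L sumSnd).prod (C₁₀ ∘L sumFst))

/-- The block diagonal operator `diag(T₀, T₁)` of two (possibly unbounded) operators, with domain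
`dom T₀ ⊕ dom T₁`. -/
def blockDiag (T₀ : H₀ →ₗ.[ℂ] H₀) (T₁ : H₁ →ₗ.[ℂ] H₁) :
    OrthSum H₀ H₁ →ₗ.[ℂ] OrthSum H₀ H₁ where
  domain := T₀.domain.comap (sumFst : OrthSum H₀ H₁ →L[ℂ] H₀).toLinearMap ⊓
    T₁.domain.comap (sumSnd : OrthSum H₀ H₁ →L[ℂ] H₁).toLinearMap
  toFun :=
    { toFun := fun x => WithLp.toLp 2 (T₀ ⟨sumFst x.1, x.2.1⟩, T₁ ⟨sumSnd x.1, x.2.2⟩)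
      map_add' := by
        intro x y
        rw [← WithLp.toLp_add, Prod.mk_add_mk, ← T₀.map_add, ← T₁.map_add]
        congr 4
      map_smul' := by
        intro c x
        rw [RingHom.id_apply, ← WithLp.toLp_smul, Prod.smul_mk, ← T₀.map_smul, ← T₁.map_smul]
        congr 4 }

/-- The operator `T + C` with `C` bounded and everywhere defined and `T` possibly unbounded;
its domain is `dom T`. -/
abbrev addBdd {E : Type*} [NormedAddCommGroup E] [InnerProductSpace ℂ E]
    (T : E →ₗ.[ℂ] E) (C : E →L[ℂ] E) : E →ₗ.[ℂ] E :=
  C.toLinearMap +ᵥ T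

/-- The operator product `R T S` with `R`, `S` bounded and everywhere defined and `T` possibly
unbounded, on its natural domain `{x | S x ∈ dom T}`. -/
def sandwich {E : Type*} [NormedAddCommGroup E] [InnerProductSpace ℂ E]
    (R : E →L[ℂ] E) (T : E →ₗ.[ℂ] E) (S : E →L[ℂ] E) : E →ₗ.[ℂ] E where
  domain := T.domain.comap S.toLinearMap
  toFun :=
    { toFun := fun x => R (T ⟨S x.1, x.2⟩)
      map_add' := by
        intro x y
        rw [← map_add, ← T.map_add]
        congr 2
        exact Subtype.ext (map_add S x.1 y.1)
      map_smul' := by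
        intro c x
        rw [RingHom.id_apply, ← map_smul, ← T.map_smul]
        congr 2
        exact Subtype.ext (map_smul S c x.1) }

/-- The graph subspace `{(x₀, x₁) | x₁ = Q x₀}` of `H₀ ⊕ H₁` associated with `(H₀, Q)`. -/
def graphSubspaceZero (Q : H₀ →L[ℂ] H₁) : Submodule ℂ (OrthSum H₀ H₁) :=
  LinearMap.ker (sumSnd - Q ∘L sumFst : OrthSum H₀ H₁ →L[ℂ] H₁).toLinearMap

/-- The graph subspace `{(x₀, x₁) | x₀ = Q x₁}` of `H₀ ⊕ H₁` associated with `(H₁, Q)`. -/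
def graphSubspaceOne (Q : H₁ →L[ℂ] H₀) : Submodule ℂ (OrthSum H₀ H₁) :=
  LinearMap.ker (sumFst - Q ∘L sumSnd : OrthSum H₀ H₁ →L[ℂ] H₀).toLinearMap

/-- The closed subspace `K` reduces the possibly unbounded operator `T`:
`dom T = (dom T ∩ K) ⊕ (dom T ∩ Kᗮ)`, and `T` maps `dom T ∩ K` into `K` and `dom T ∩ Kᗮ`
into `Kᗮ`. -/
structure IsReducingSubspace {E : Type*} [NormedAddCommGroup E] [InnerProductSpace ℂ E]
    (K : Submodule ℂ E) (T : E →ₗ.[ℂ] E) : Prop where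
  isClosed : IsClosed (K : Set E)
  domain_le : T.domain ≤ (T.domain ⊓ K) ⊔ (T.domain ⊓ Kᗮ)
  map_mem : ∀ x : T.domain, (x : E) ∈ K → T x ∈ K
  map_mem_orthogonal : ∀ x : T.domain, (x : E) ∈ Kᗮ → T x ∈ Kᗮ

/-- The operator `(I + Q* Q)^{1/2} (A + B Q) (I + Q* Q)^{-1/2}` in `E`, on its natural domain;
the powers of the bounded positive operator `I + Q* Q` are those of the functional calculus. -/
def diagonalizedEntry {E F : Type*}
    [NormedAddCommGroup E] [InnerProductSpace ℂ E] [CompleteSpace E]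
    [NormedAddCommGroup F] [InnerProductSpace ℂ F] [CompleteSpace F]
    (A : E →ₗ.[ℂ] E) (B : F →L[ℂ] E) (Q : E →L[ℂ] F) : E →ₗ.[ℂ] E :=
  sandwich ((1 + Q.adjoint ∘L Q) ^ (1 / 2 : ℝ)) (addBdd A (B ∘L Q))
    ((1 + Q.adjoint ∘L Q) ^ (-(1 / 2) : ℝ))

/-- `U` is the unitary operator from the polar decomposition `V = U |V|`, where
`|V| = (V* V)^{1/2}`. -/
def IsUnitaryPolarFactor {E : Type*}
    [NormedAddCommGroup E] [InnerProductSpace ℂ E] [CompleteSpace E] (U V : E →L[ℂ] E) : Prop :=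
  U ∈ unitary (E →L[ℂ] E) ∧ V = U * CFC.abs V

end Blocks

/-! `V` carries `H₀ ⊕ 0` onto the graph `G₀` and `0 ⊕ H₁` onto `G₁ = G₀ᗮ`, so invariance of both
graphs makes `V⁻¹ H V` block diagonal. Reading the first component of `H` on `G₀` and the second on
`G₁` gives the entries. `V` is invertible because its off-diagonal part is skew-adjoint. The
delicate point is the equality of domains, which needs `Q₁₀` to map `dom A₀` into `dom A₁`, and
symmetrically for `Q₀₁`. This comes from comparing two equations at a point `it` with `t` large: `H
- it` is onto, even within `G₀` (`IsReducingSubspace.exists_mem_sub_smul_eq`), while `A₀ + B₀₁ Q₁₀ -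
it` is injective. Finally `V* V` is block diagonal, hence so is `|V|`, and conjugating (ii) by `|V|`
gives (iii). -/

/-! ### Self-adjoint operators: bounded perturbation and solvability of `T - it`. -/

section SelfAdjoint

variable {E : Type*} [NormedAddCommGroup E] [InnerProductSpace ℂ E]

/-- For a symmetric operator `T` and real `t`, `‖(T - it) x‖² = ‖T x‖² + t² ‖x‖²`. -/
theorem LinearPMap.IsFormalAdjoint.norm_sub_I_smul_sq {T : E →ₗ.[ℂ] E}
    (hT : T.IsFormalAdjoint T) (t : ℝ) (x : T.domain) :
    ‖T x - (t * Complex.I) • (x : E)‖ ^ 2 = ‖T x‖ ^ 2 + t ^ 2 * ‖(x : E)‖ ^ 2 := by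
  -- The cross term vanishes: `⟪T x, x⟫` is real, and the factor `it` makes it purely imaginary.
  have h0 : RCLike.re ⟪T x, (t * Complex.I) • (x : E)⟫_ℂ = 0 := by
    have him : (⟪T x, (x : E)⟫_ℂ).im = 0 := by
      have h := congrArg Complex.im (inner_conj_symm (T x) (x : E))
      rw [← hT x x, Complex.conj_im] at h
      linarith
    rw [inner_smul_right]
    simp [him]
  rw [@norm_sub_sq ℂ, h0, norm_smul, mul_pow]
  simp

/-- On a domain vector, a symmetric operator plus a bounded one, shifted far enough along the
imaginary axis, is injective. -/
theorem LinearPMap.IsFormalAdjoint.eq_zero_of_addBdd_sub_I_smul {T : E →ₗ.[ℂ] E}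
    (hT : T.IsFormalAdjoint T) {C : E →L[ℂ] E} {t : ℝ} (ht : ‖C‖ < t) (x : T.domain)
    (hx : T x + C x - (t * Complex.I) • (x : E) = 0) : (x : E) = 0 := by
  have h1 := hT.norm_sub_I_smul_sq t x
  have h2 : T x - (t * Complex.I) • (x : E) = -C x := by
    rw [← sub_eq_zero, ← hx]; abel
  rw [h2, norm_neg] at h1
  have h3 : t * ‖(x : E)‖ ≤ ‖C x‖ := by
    refine le_of_sq_le_sq ?_ (norm_nonneg _)
    rw [h1, mul_pow]
    nlinarith [sq_nonneg ‖T x‖]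
  have h4 := C.le_opNorm x
  by_contra h
  have : 0 < ‖(x : E)‖ := norm_pos_iff.mpr h
  nlinarith

/-- If `K` reduces `T` and `T - c` is onto, then so is its restriction to `K`. -/
theorem IsReducingSubspace.exists_mem_sub_smul_eq {K : Submodule ℂ E} {T : E →ₗ.[ℂ] E}
    (hK : IsReducingSubspace K T) {c : ℂ} (hc : ∀ y, ∃ x : T.domain, T x - c • (x : E) = y)
    {y : E} (hy : y ∈ K) : ∃ x : T.domain, (x : E) ∈ K ∧ T x - c • (x : E) = y := by
  obtain ⟨x, hx⟩ := hc y
  obtain ⟨a, ⟨haT, haK⟩, b, ⟨hbT, hbK⟩, hab⟩ := Submodule.mem_sup.mp (hK.domain_le x.2)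
  refine ⟨⟨a, haT⟩, haK, ?_⟩
  have hsum : x = ⟨a, haT⟩ + ⟨b, hbT⟩ := Subtype.ext hab.symm
  have h1 : T ⟨a, haT⟩ - c • a ∈ K := K.sub_mem (hK.map_mem ⟨a, haT⟩ haK) (K.smul_mem c haK)
  have h2 : T ⟨b, hbT⟩ - c • b ∈ Kᗮ :=
    Kᗮ.sub_mem (hK.map_mem_orthogonal ⟨b, hbT⟩ hbK) (Kᗮ.smul_mem c hbK)
  have h3 : y - (T ⟨a, haT⟩ - c • a) = T ⟨b, hbT⟩ - c • b := by
    rw [← hx, ← hab, hsum, T.map_add, smul_add]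
    abel
  -- This vector lies in both `K` and `Kᗮ`.
  have h4 : y - (T ⟨a, haT⟩ - c • a) = 0 := by
    refine (inner_self_eq_zero (𝕜 := ℂ)).mp (Submodule.inner_right_of_mem_orthogonal
      (K.sub_mem hy h1) (h3 ▸ h2))
  exact (sub_eq_zero.mp h4).symm

variable [CompleteSpace E]

theorem IsSelfAdjoint.linearPMap_isFormalAdjoint {T : E →ₗ.[ℂ] E} (hT : IsSelfAdjoint T) :
    T.IsFormalAdjoint T := by
  have h := LinearPMap.adjoint_isFormalAdjoint hT.dense_domain
  rwa [LinearPMap.isSelfAdjoint_def.mp hT] at h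

theorem IsSelfAdjoint.mem_linearPMap_domain {T : E →ₗ.[ℂ] E} (hT : IsSelfAdjoint T) {y w : E}
    (h : ∀ x : T.domain, ⟪w, x⟫_ℂ = ⟪y, T x⟫_ℂ) : y ∈ T.domain := by
  have hy := T.mem_adjoint_domain_of_exists y ⟨w, h⟩
  rwa [LinearPMap.isSelfAdjoint_def.mp hT] at hy

/-- Symmetry gives `T ≤ T.adjoint`; `hm` is the reverse inclusion of domains, stated without the
adjoint. -/
theorem LinearPMap.isSelfAdjoint_of_isFormalAdjoint {T : E →ₗ.[ℂ] E}
    (hd : Dense (T.domain : Set E)) (hs : T.IsFormalAdjoint T)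
    (hm : ∀ y w : E, (∀ x : T.domain, ⟪w, x⟫_ℂ = ⟪y, T x⟫_ℂ) → y ∈ T.domain) :
    IsSelfAdjoint T := by
  have hle : T ≤ T.adjoint := hs.le_adjoint hd
  rw [LinearPMap.isSelfAdjoint_def]
  refine (LinearPMap.eq_of_le_of_domain_eq hle (le_antisymm hle.1 fun y hy => ?_)).symm
  exact hm y (T.adjoint ⟨y, hy⟩) fun x => LinearPMap.adjoint_isFormalAdjoint hd ⟨y, hy⟩ x

theorem IsSelfAdjoint.addBdd {T : E →ₗ.[ℂ] E} (hT : IsSelfAdjoint T) {C : E →L[ℂ] E}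
    (hC : C.adjoint = C) : IsSelfAdjoint (addBdd T C) := by
  have hsymm (x y : E) : ⟪C x, y⟫_ℂ = ⟪x, C y⟫_ℂ := by
    conv_lhs => rw [← hC, ContinuousLinearMap.adjoint_inner_left]
  refine LinearPMap.isSelfAdjoint_of_isFormalAdjoint hT.dense_domain (fun x y => ?_)
    fun y w h => ?_
  · have := hT.linearPMap_isFormalAdjoint x y
    simp only [LinearPMap.vadd_apply, inner_add_left, inner_add_right]
    rw [this]
    exact congrArg (· + _) (hsymm _ _)
  · refine hT.mem_linearPMap_domain (w := w - C y) fun x => ?_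
    have := h x
    simp only [LinearPMap.vadd_apply, inner_add_right] at this
    rw [inner_sub_left, this, hsymm]
    exact add_sub_cancel_left _ _

/-- The operator `T - it` of a self-adjoint `T` is onto for real `t ≥ 1`. -/
theorem IsSelfAdjoint.exists_sub_I_smul_eq {T : E →ₗ.[ℂ] E} (hT : IsSelfAdjoint T) {t : ℝ}
    (ht : 1 ≤ t) (y : E) : ∃ x : T.domain, T x - (t * Complex.I) • (x : E) = y := by
  have hs := hT.linearPMap_isFormalAdjoint
  -- `T - it` becomes a bounded map `f` on the graph of `T`, which is complete because `T` is
  -- closed.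
  let g : E × E →L[ℂ] E :=
    ContinuousLinearMap.snd ℂ E E - (t * Complex.I) • ContinuousLinearMap.fst ℂ E E
  let f : T.graph →L[ℂ] E := g ∘L T.graph.subtypeL
  have hf (x : T.domain) : f ⟨(x, T x), T.mem_graph x⟩ = T x - (t * Complex.I) • (x : E) := rfl
  have hgraph : IsClosed (T.graph : Set (E × E)) := hT.isClosed
  have : CompleteSpace T.graph := hgraph.completeSpace_coe
  -- The graph carries the sup norm, and `t ≥ 1` lets `‖(T - it) x‖` dominate both `‖x‖` and `‖T
  -- x‖`.
  have hanti : AntilipschitzWith 1 f := by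
    refine ContinuousLinearMap.antilipschitz_of_bound f fun p => ?_
    obtain ⟨⟨a, b⟩, hp⟩ := p
    obtain ⟨x, rfl, rfl⟩ := T.mem_graph_iff.mp hp
    have h1 := hs.norm_sub_I_smul_sq t x
    rw [NNReal.coe_one, one_mul, hf]
    change max ‖(x : E)‖ ‖T x‖ ≤ _
    refine max_le ?_ ?_
    · refine le_of_sq_le_sq ?_ (norm_nonneg _)
      rw [h1]
      nlinarith [sq_nonneg ‖T x‖, sq_nonneg ‖(x : E)‖,
        mul_le_mul_of_nonneg_right (one_le_pow₀ ht (n := 2)) (sq_nonneg ‖(x : E)‖)]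
    · refine le_of_sq_le_sq ?_ (norm_nonneg _)
      rw [h1]
      nlinarith [mul_nonneg (sq_nonneg t) (sq_nonneg ‖(x : E)‖)]
  have hclosed : IsClosed (f.range : Set E) := by
    exact hanti.isClosed_range f.uniformContinuous
  have : CompleteSpace f.range := hclosed.completeSpace_coe
  -- A vector `z` orthogonal to the range satisfies `T z = -it z`, so the norm identity at `-t`
  -- forces `z = 0`.
  have htop : f.range = ⊤ := by
    rw [← Submodule.orthogonal_eq_bot_iff, Submodule.eq_bot_iff]
    intro z hz
    have hz' (x : T.domain) : ⟪z, T x⟫_ℂ - (t * Complex.I) * ⟪z, (x : E)⟫_ℂ = 0 := by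
      rw [← inner_smul_right, ← inner_sub_right, ← hf]
      exact Submodule.inner_left_of_mem_orthogonal (LinearMap.mem_range_self f.toLinearMap _) hz
    have hzd : z ∈ T.domain := by
      refine hT.mem_linearPMap_domain (w := -(t * Complex.I) • z) fun x => ?_
      rw [inner_smul_left, eq_comm, ← sub_eq_zero, ← hz' x]
      simp
    have hTz : T ⟨z, hzd⟩ - ((-t : ℝ) * Complex.I) • z = 0 := by
      refine hT.dense_domain.eq_zero_of_inner_left ℂ fun v hv => ?_
      have h2 := hs ⟨z, hzd⟩ ⟨v, hv⟩
      rw [inner_sub_left, h2, inner_smul_left, ← hz' ⟨v, hv⟩]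
      simp
    have h3 := hs.norm_sub_I_smul_sq (-t) ⟨z, hzd⟩
    rw [hTz] at h3
    have h4 : t ^ 2 * ‖z‖ ^ 2 ≤ 0 := by
      have := sq_nonneg ‖T ⟨z, hzd⟩‖
      simp at h3
      linarith
    have h5 : ‖z‖ ^ 2 ≤ 0 := by
      nlinarith [mul_le_mul_of_nonneg_right (one_le_pow₀ ht (n := 2)) (sq_nonneg ‖z‖)]
    simpa using h5
  obtain ⟨⟨⟨a, b⟩, hp⟩, hy⟩ := (htop ▸ Submodule.mem_top : y ∈ f.range)
  obtain ⟨x, rfl, rfl⟩ := T.mem_graph_iff.mp hp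
  exact ⟨x, hy⟩

end SelfAdjoint

/-! ### Block operators on the orthogonal sum. -/

section OrthSumLemmas

variable {H₀ H₁ : Type*}
  [NormedAddCommGroup H₀] [InnerProductSpace ℂ H₀]
  [NormedAddCommGroup H₁] [InnerProductSpace ℂ H₁]

theorem sumFst_toLp (a : H₀) (b : H₁) : sumFst (WithLp.toLp 2 (a, b)) = a := rfl

theorem sumSnd_toLp (a : H₀) (b : H₁) : sumSnd (WithLp.toLp 2 (a, b)) = b := rfl

theorem OrthSum.toLp_sumFst_sumSnd (x : OrthSum H₀ H₁) :
    WithLp.toLp 2 (sumFst x, sumSnd x) = x := rfl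

theorem OrthSum.ext_sum {x y : OrthSum H₀ H₁} (h₀ : sumFst x = sumFst y)
    (h₁ : sumSnd x = sumSnd y) : x = y := by
  rw [← toLp_sumFst_sumSnd x, ← toLp_sumFst_sumSnd y, h₀, h₁]

theorem OrthSum.inner_eq (x y : OrthSum H₀ H₁) :
    ⟪x, y⟫_ℂ = ⟪sumFst x, sumFst y⟫_ℂ + ⟪sumSnd x, sumSnd y⟫_ℂ :=
  WithLp.prod_inner_apply x y

theorem sumFst_offDiag (C₀₁ : H₁ →L[ℂ] H₀) (C₁₀ : H₀ →L[ℂ] H₁) (x : OrthSum H₀ H₁) :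
    sumFst (offDiag C₀₁ C₁₀ x) = C₀₁ (sumSnd x) := rfl

theorem sumSnd_offDiag (C₀₁ : H₁ →L[ℂ] H₀) (C₁₀ : H₀ →L[ℂ] H₁) (x : OrthSum H₀ H₁) :
    sumSnd (offDiag C₀₁ C₁₀ x) = C₁₀ (sumFst x) := rfl

theorem blockDiag_apply (T₀ : H₀ →ₗ.[ℂ] H₀) (T₁ : H₁ →ₗ.[ℂ] H₁) (x : (blockDiag T₀ T₁).domain) :
    blockDiag T₀ T₁ x =
      WithLp.toLp 2 (T₀ ⟨sumFst x.1, x.2.1⟩, T₁ ⟨sumSnd x.1, x.2.2⟩) := rfl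

theorem sandwich_apply {E : Type*} [NormedAddCommGroup E] [InnerProductSpace ℂ E]
    (R : E →L[ℂ] E) (T : E →ₗ.[ℂ] E) (S : E →L[ℂ] E) (x : (sandwich R T S).domain) :
    sandwich R T S x = R (T ⟨S x.1, x.2⟩) := rfl

/-- The bounded block diagonal operator `diag(P₀, P₁)`. -/
noncomputable def boundedBlockDiag (P₀ : H₀ →L[ℂ] H₀) (P₁ : H₁ →L[ℂ] H₁) :
    OrthSum H₀ H₁ →L[ℂ] OrthSum H₀ H₁ :=
  ((WithLp.prodContinuousLinearEquiv 2 ℂ H₀ H₁).symm : H₀ × H₁ →L[ℂ] OrthSum H₀ H₁) ∘L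
    ((P₀ ∘L sumFst).prod (P₁ ∘L sumSnd))

theorem sumFst_boundedBlockDiag (P₀ : H₀ →L[ℂ] H₀) (P₁ : H₁ →L[ℂ] H₁) (x : OrthSum H₀ H₁) :
    sumFst (boundedBlockDiag P₀ P₁ x) = P₀ (sumFst x) := rfl

theorem sumSnd_boundedBlockDiag (P₀ : H₀ →L[ℂ] H₀) (P₁ : H₁ →L[ℂ] H₁) (x : OrthSum H₀ H₁) :
    sumSnd (boundedBlockDiag P₀ P₁ x) = P₁ (sumSnd x) := rfl

theorem boundedBlockDiag_mul (P₀ R₀ : H₀ →L[ℂ] H₀) (P₁ R₁ : H₁ →L[ℂ] H₁) :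
    boundedBlockDiag P₀ P₁ * boundedBlockDiag R₀ R₁ = boundedBlockDiag (P₀ * R₀) (P₁ * R₁) := rfl

theorem boundedBlockDiag_one :
    boundedBlockDiag (1 : H₀ →L[ℂ] H₀) (1 : H₁ →L[ℂ] H₁) = 1 := rfl

theorem sandwich_boundedBlockDiag (R₀ S₀ : H₀ →L[ℂ] H₀) (R₁ S₁ : H₁ →L[ℂ] H₁)
    (T₀ : H₀ →ₗ.[ℂ] H₀) (T₁ : H₁ →ₗ.[ℂ] H₁) :
    sandwich (boundedBlockDiag R₀ R₁) (blockDiag T₀ T₁) (boundedBlockDiag S₀ S₁) =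
      blockDiag (sandwich R₀ T₀ S₀) (sandwich R₁ T₁ S₁) := rfl

theorem mem_graphSubspaceZero {Q : H₀ →L[ℂ] H₁} {x : OrthSum H₀ H₁} :
    x ∈ graphSubspaceZero Q ↔ sumSnd x = Q (sumFst x) := by
  simp [graphSubspaceZero, sub_eq_zero]

theorem mem_graphSubspaceOne {Q : H₁ →L[ℂ] H₀} {x : OrthSum H₀ H₁} :
    x ∈ graphSubspaceOne Q ↔ sumFst x = Q (sumSnd x) := by
  simp [graphSubspaceOne, sub_eq_zero]

/-- Replaces the conjugation by the intertwining `H V = V diag(T₀, T₁)`, so that `V⁻¹` never has to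
be computed. -/
theorem sandwich_inverse_eq_blockDiag {T₀ : H₀ →ₗ.[ℂ] H₀} {T₁ : H₁ →ₗ.[ℂ] H₁}
    {H : OrthSum H₀ H₁ →ₗ.[ℂ] OrthSum H₀ H₁} {V : OrthSum H₀ H₁ →L[ℂ] OrthSum H₀ H₁}
    (hV : IsUnit V) (hdom : ∀ x, V x ∈ H.domain ↔ sumFst x ∈ T₀.domain ∧ sumSnd x ∈ T₁.domain)
    (h : ∀ (x : OrthSum H₀ H₁) (hx : V x ∈ H.domain) (h₀ : sumFst x ∈ T₀.domain)
      (h₁ : sumSnd x ∈ T₁.domain),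
      H ⟨V x, hx⟩ = V (WithLp.toLp 2 (T₀ ⟨sumFst x, h₀⟩, T₁ ⟨sumSnd x, h₁⟩))) :
    sandwich (Ring.inverse V) H V = blockDiag T₀ T₁ := by
  refine LinearPMap.ext (Submodule.ext hdom) fun x hx hx' => ?_
  rw [sandwich_apply, h x hx hx'.1 hx'.2, blockDiag_apply]
  exact DFunLike.congr_fun (Ring.inverse_mul_cancel V hV) _

theorem boundedBlockDiag_nonneg {P₀ : H₀ →L[ℂ] H₀} {P₁ : H₁ →L[ℂ] H₁} (h₀ : 0 ≤ P₀)
    (h₁ : 0 ≤ P₁) : 0 ≤ boundedBlockDiag P₀ P₁ := by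
  rw [ContinuousLinearMap.nonneg_iff_isPositive] at h₀ h₁ ⊢
  rw [ContinuousLinearMap.isPositive_iff_complex] at h₀ h₁ ⊢
  intro x
  have e₀ := h₀ (sumFst x)
  have e₁ := h₁ (sumSnd x)
  simp only [OrthSum.inner_eq, sumFst_boundedBlockDiag, sumSnd_boundedBlockDiag, map_add]
  refine ⟨?_, add_nonneg e₀.2 e₁.2⟩
  exact (Complex.ofReal_add _ _).trans (congrArg₂ (· + ·) e₀.1 e₁.1)

variable [CompleteSpace H₀] [CompleteSpace H₁]

theorem adjoint_offDiag (C₀₁ : H₁ →L[ℂ] H₀) (C₁₀ : H₀ →L[ℂ] H₁) :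
    (offDiag C₀₁ C₁₀).adjoint = offDiag C₁₀.adjoint C₀₁.adjoint := by
  symm
  rw [ContinuousLinearMap.eq_adjoint_iff]
  intro x y
  simp only [OrthSum.inner_eq, sumFst_offDiag, sumSnd_offDiag,
    ContinuousLinearMap.adjoint_inner_left]
  exact add_comm _ _

theorem IsSelfAdjoint.blockDiag {T₀ : H₀ →ₗ.[ℂ] H₀} {T₁ : H₁ →ₗ.[ℂ] H₁} (h₀ : IsSelfAdjoint T₀)
    (h₁ : IsSelfAdjoint T₁) : IsSelfAdjoint (blockDiag T₀ T₁) := by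
  refine LinearPMap.isSelfAdjoint_of_isFormalAdjoint ?_ (fun x y => ?_) fun y w h => ⟨?_, ?_⟩
  · have h := (h₀.dense_domain.prod h₁.dense_domain).preimage
      (WithLp.prodContinuousLinearEquiv 2 ℂ H₀ H₁).toHomeomorph.isOpenMap
    exact h
  · rw [OrthSum.inner_eq, OrthSum.inner_eq]
    exact congrArg₂ (· + ·)
      (h₀.linearPMap_isFormalAdjoint ⟨sumFst x.1, x.2.1⟩ ⟨sumFst y.1, y.2.1⟩)
      (h₁.linearPMap_isFormalAdjoint ⟨sumSnd x.1, x.2.2⟩ ⟨sumSnd y.1, y.2.2⟩)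
  · refine h₀.mem_linearPMap_domain (w := sumFst w) fun x => ?_
    have := h ⟨WithLp.toLp 2 ((x : H₀), 0), x.2, T₁.domain.zero_mem⟩
    rw [blockDiag_apply, OrthSum.inner_eq, OrthSum.inner_eq] at this
    simp only [sumFst_toLp, sumSnd_toLp, inner_zero_right, add_zero] at this
    have h0 : T₁ ⟨0, T₁.domain.zero_mem⟩ = 0 := T₁.map_zero
    rw [this, h0, inner_zero_right, add_zero]
    rfl
  · refine h₁.mem_linearPMap_domain (w := sumSnd w) fun x => ?_
    have := h ⟨WithLp.toLp 2 (0, (x : H₁)), T₀.domain.zero_mem, x.2⟩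
    rw [blockDiag_apply, OrthSum.inner_eq, OrthSum.inner_eq] at this
    simp only [sumFst_toLp, sumSnd_toLp, inner_zero_right, zero_add] at this
    have h0 : T₀ ⟨0, T₀.domain.zero_mem⟩ = 0 := T₀.map_zero
    rw [this, h0, inner_zero_right, zero_add]
    rfl

end OrthSumLemmas

/-! ### Reducing graph subspaces and the domain of `H V`. -/

section GraphSubspaces

variable {H₀ H₁ : Type*}
  [NormedAddCommGroup H₀] [InnerProductSpace ℂ H₀]
  [NormedAddCommGroup H₁] [InnerProductSpace ℂ H₁]

/-- For symmetric `T` and `‖C‖ < t`, the operator `T + C - it` is injective on `dom T`. -/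
theorem LinearPMap.IsFormalAdjoint.injective_addBdd_sub_I_smul {E : Type*} [NormedAddCommGroup E]
    [InnerProductSpace ℂ E] {T : E →ₗ.[ℂ] E} (hT : T.IsFormalAdjoint T) {C : E →L[ℂ] E} {t : ℝ}
    (ht : ‖C‖ < t) {x y : T.domain}
    (h : T x + C x - (t * Complex.I) • (x : E) = T y + C y - (t * Complex.I) • (y : E)) :
    (x : E) = y := by
  rw [← sub_eq_zero]
  refine hT.eq_zero_of_addBdd_sub_I_smul ht (x - y) ?_
  rw [T.map_sub, Submodule.coe_sub, C.map_sub, smul_sub, ← sub_eq_zero.mpr h]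
  abel

variable [CompleteSpace H₀] [CompleteSpace H₁]

/-- With `g = (A₀ + B₀₁ Q - it) u`, solve `(H - it) x = (g, Q g)` inside the graph. The first
component of `x` solves the same equation as `u`, so it equals `u`, and `Q u` is the second
component of a vector of `dom H`. -/
theorem map_domain_of_isReducingSubspace_graphSubspaceZero
    {A₀ : H₀ →ₗ.[ℂ] H₀} {A₁ : H₁ →ₗ.[ℂ] H₁} (hA₀ : IsSelfAdjoint A₀)
    {B₀₁ : H₁ →L[ℂ] H₀} {B₁₀ : H₀ →L[ℂ] H₁} {Q : H₀ →L[ℂ] H₁}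
    (hH : IsSelfAdjoint (addBdd (blockDiag A₀ A₁) (offDiag B₀₁ B₁₀)))
    (hG : IsReducingSubspace (graphSubspaceZero Q) (addBdd (blockDiag A₀ A₁) (offDiag B₀₁ B₁₀)))
    {u : H₀} (hu : u ∈ A₀.domain) : Q u ∈ A₁.domain := by
  -- `1 ≤ t` serves surjectivity of `H - it`, and `‖B₀₁ Q‖ < t` injectivity of `A₀ + B₀₁ Q - it`.
  obtain ⟨t, ht1, ht2⟩ : ∃ t : ℝ, 1 ≤ t ∧ ‖B₀₁ ∘L Q‖ < t :=
    ⟨‖B₀₁ ∘L Q‖ + 1, by linarith [norm_nonneg (B₀₁ ∘L Q)], by linarith⟩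
  let g := A₀ ⟨u, hu⟩ + (B₀₁ ∘L Q) u - (t * Complex.I) • u
  have hg : (WithLp.toLp 2 (g, Q g) : OrthSum H₀ H₁) ∈ graphSubspaceZero Q :=
    mem_graphSubspaceZero.mpr rfl
  obtain ⟨x, hxG, hx⟩ := hG.exists_mem_sub_smul_eq (hH.exists_sub_I_smul_eq ht1) hg
  rw [mem_graphSubspaceZero] at hxG
  have hx' : B₀₁ (sumSnd x.1) + A₀ ⟨sumFst x.1, x.2.1⟩ - (t * Complex.I) • sumFst x.1 = g :=
    congrArg sumFst hx
  rw [congrArg B₀₁ hxG, add_comm (B₀₁ _)] at hx'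
  have := hA₀.linearPMap_isFormalAdjoint.injective_addBdd_sub_I_smul ht2
    (x := ⟨sumFst x.1, x.2.1⟩) (y := ⟨u, hu⟩) hx'
  change sumFst x.1 = u at this
  rw [← this, ← hxG]
  exact x.2.2

theorem map_domain_of_isReducingSubspace_graphSubspaceOne
    {A₀ : H₀ →ₗ.[ℂ] H₀} {A₁ : H₁ →ₗ.[ℂ] H₁} (hA₁ : IsSelfAdjoint A₁)
    {B₀₁ : H₁ →L[ℂ] H₀} {B₁₀ : H₀ →L[ℂ] H₁} {Q : H₁ →L[ℂ] H₀}
    (hH : IsSelfAdjoint (addBdd (blockDiag A₀ A₁) (offDiag B₀₁ B₁₀)))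
    (hG : IsReducingSubspace (graphSubspaceOne Q) (addBdd (blockDiag A₀ A₁) (offDiag B₀₁ B₁₀)))
    {u : H₁} (hu : u ∈ A₁.domain) : Q u ∈ A₀.domain := by
  obtain ⟨t, ht1, ht2⟩ : ∃ t : ℝ, 1 ≤ t ∧ ‖B₁₀ ∘L Q‖ < t :=
    ⟨‖B₁₀ ∘L Q‖ + 1, by linarith [norm_nonneg (B₁₀ ∘L Q)], by linarith⟩
  let g := A₁ ⟨u, hu⟩ + (B₁₀ ∘L Q) u - (t * Complex.I) • u
  have hg : (WithLp.toLp 2 (Q g, g) : OrthSum H₀ H₁) ∈ graphSubspaceOne Q :=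
    mem_graphSubspaceOne.mpr rfl
  obtain ⟨x, hxG, hx⟩ := hG.exists_mem_sub_smul_eq (hH.exists_sub_I_smul_eq ht1) hg
  rw [mem_graphSubspaceOne] at hxG
  have hx' : B₁₀ (sumFst x.1) + A₁ ⟨sumSnd x.1, x.2.2⟩ - (t * Complex.I) • sumSnd x.1 = g :=
    congrArg sumSnd hx
  rw [congrArg B₁₀ hxG, add_comm (B₁₀ _)] at hx'
  have := hA₁.linearPMap_isFormalAdjoint.injective_addBdd_sub_I_smul ht2
    (x := ⟨sumSnd x.1, x.2.2⟩) (y := ⟨u, hu⟩) hx'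
  change sumSnd x.1 = u at this
  rw [← this, ← hxG]
  exact x.2.1

theorem graphSubspaceZero_orthogonal (Q : H₀ →L[ℂ] H₁) :
    (graphSubspaceZero Q)ᗮ = graphSubspaceOne (-Q.adjoint) := by
  ext y
  rw [mem_graphSubspaceOne, Submodule.mem_orthogonal]
  have key (a : H₀) : ⟪(WithLp.toLp 2 (a, Q a) : OrthSum H₀ H₁), y⟫_ℂ =
      ⟪a, sumFst y + Q.adjoint (sumSnd y)⟫_ℂ := by
    rw [OrthSum.inner_eq, inner_add_right, ContinuousLinearMap.adjoint_inner_right]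
    rfl
  constructor
  · intro h
    refine eq_neg_of_add_eq_zero_left (ext_inner_left ℂ fun a => ?_)
    rw [inner_zero_right]
    exact (key a).symm.trans (h _ (mem_graphSubspaceZero.mpr rfl))
  · intro h x hx
    rw [mem_graphSubspaceZero] at hx
    rw [← OrthSum.toLp_sumFst_sumSnd x, hx, key, h]
    simp

theorem one_add_offDiag_mem_domain_iff
    {A₀ : H₀ →ₗ.[ℂ] H₀} {A₁ : H₁ →ₗ.[ℂ] H₁} (hA₀ : IsSelfAdjoint A₀) (hA₁ : IsSelfAdjoint A₁)
    {B₀₁ : H₁ →L[ℂ] H₀} {B₁₀ : H₀ →L[ℂ] H₁} {Q₁₀ : H₀ →L[ℂ] H₁}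
    (hH : IsSelfAdjoint (addBdd (blockDiag A₀ A₁) (offDiag B₀₁ B₁₀)))
    (hG₀ : IsReducingSubspace (graphSubspaceZero Q₁₀)
      (addBdd (blockDiag A₀ A₁) (offDiag B₀₁ B₁₀)))
    (hG₁ : IsReducingSubspace (graphSubspaceOne (-Q₁₀.adjoint))
      (addBdd (blockDiag A₀ A₁) (offDiag B₀₁ B₁₀)))
    (hV : IsUnit (1 + offDiag (-Q₁₀.adjoint) Q₁₀)) (x : OrthSum H₀ H₁) :
    (1 + offDiag (-Q₁₀.adjoint) Q₁₀ : OrthSum H₀ H₁ →L[ℂ] OrthSum H₀ H₁) x ∈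
        (addBdd (blockDiag A₀ A₁) (offDiag B₀₁ B₁₀)).domain ↔
      sumFst x ∈ A₀.domain ∧ sumSnd x ∈ A₁.domain := by
  constructor
  · intro hx
    obtain ⟨a, ⟨haT, haG⟩, b, ⟨hbT, hbG⟩, hab⟩ := Submodule.mem_sup.mp (hG₀.domain_le hx)
    rw [graphSubspaceZero_orthogonal] at hbG
    have haG := mem_graphSubspaceZero.mp haG
    have hbG := mem_graphSubspaceOne.mp hbG
    have hinj := ((ContinuousLinearMap.isUnit_iff_bijective).mp hV).1
    -- Since `a = V (a₀, 0)` and `b = V (0, b₁)`, injectivity of `V` identifies `x`.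
    have : x = WithLp.toLp 2 (sumFst a, sumSnd b) := by
      apply hinj
      rw [← hab]
      refine OrthSum.ext_sum ?_ ?_
      · rw [map_add, hbG]; rfl
      · rw [map_add, haG, add_comm]; rfl
    rw [this]
    exact ⟨haT.1, hbT.2⟩
  · rintro ⟨h₀, h₁⟩
    exact ⟨A₀.domain.add_mem h₀
        (map_domain_of_isReducingSubspace_graphSubspaceOne hA₁ hH hG₁ h₁),
      A₁.domain.add_mem h₁
        (map_domain_of_isReducingSubspace_graphSubspaceZero hA₀ hH hG₀ h₀)⟩

/-- Split `V x` into its parts `a`, `b` in the two graphs. As `H a` and `H b` stay there, each is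
determined by one component, which is the corresponding diagonal entry. -/
theorem addBdd_blockDiag_one_add_offDiag_apply
    {A₀ : H₀ →ₗ.[ℂ] H₀} {A₁ : H₁ →ₗ.[ℂ] H₁} (hA₀ : IsSelfAdjoint A₀) (hA₁ : IsSelfAdjoint A₁)
    {B₀₁ : H₁ →L[ℂ] H₀} {B₁₀ : H₀ →L[ℂ] H₁} {Q₀₁ : H₁ →L[ℂ] H₀} {Q₁₀ : H₀ →L[ℂ] H₁}
    (hH : IsSelfAdjoint (addBdd (blockDiag A₀ A₁) (offDiag B₀₁ B₁₀)))
    (hG₀ : IsReducingSubspace (graphSubspaceZero Q₁₀)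
      (addBdd (blockDiag A₀ A₁) (offDiag B₀₁ B₁₀)))
    (hG₁ : IsReducingSubspace (graphSubspaceOne Q₀₁)
      (addBdd (blockDiag A₀ A₁) (offDiag B₀₁ B₁₀)))
    (x : OrthSum H₀ H₁)
    (hx : (1 + offDiag Q₀₁ Q₁₀ : OrthSum H₀ H₁ →L[ℂ] OrthSum H₀ H₁) x ∈
      (addBdd (blockDiag A₀ A₁) (offDiag B₀₁ B₁₀)).domain)
    (h₀ : sumFst x ∈ A₀.domain) (h₁ : sumSnd x ∈ A₁.domain) :
    addBdd (blockDiag A₀ A₁) (offDiag B₀₁ B₁₀) ⟨_, hx⟩ =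
      (1 + offDiag Q₀₁ Q₁₀ : OrthSum H₀ H₁ →L[ℂ] OrthSum H₀ H₁)
        (WithLp.toLp 2 (addBdd A₀ (B₀₁ ∘L Q₁₀) ⟨sumFst x, h₀⟩,
          addBdd A₁ (B₁₀ ∘L Q₀₁) ⟨sumSnd x, h₁⟩)) := by
  let H := addBdd (blockDiag A₀ A₁) (offDiag B₀₁ B₁₀)
  let a : H.domain := ⟨WithLp.toLp 2 (sumFst x, Q₁₀ (sumFst x)), h₀,
    map_domain_of_isReducingSubspace_graphSubspaceZero hA₀ hH hG₀ h₀⟩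
  let b : H.domain := ⟨WithLp.toLp 2 (Q₀₁ (sumSnd x), sumSnd x),
    map_domain_of_isReducingSubspace_graphSubspaceOne hA₁ hH hG₁ h₁, h₁⟩
  have hab : (⟨_, hx⟩ : H.domain) = a + b := by
    refine Subtype.ext (OrthSum.ext_sum rfl ?_)
    exact add_comm (sumSnd x) (Q₁₀ (sumFst x))
  have ha : sumSnd (H a) = Q₁₀ (sumFst (H a)) :=
    mem_graphSubspaceZero.mp (hG₀.map_mem a (mem_graphSubspaceZero.mpr rfl))
  have hb : sumFst (H b) = Q₀₁ (sumSnd (H b)) :=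
    mem_graphSubspaceOne.mp (hG₁.map_mem b (mem_graphSubspaceOne.mpr rfl))
  change H ⟨_, hx⟩ = _
  rw [hab, H.map_add]
  refine OrthSum.ext_sum ?_ ?_
  · rw [map_add, hb]; rfl
  · rw [map_add, ha, add_comm]; rfl

end GraphSubspaces

/-! ### Invertibility of `V` and its polar decomposition. -/

section Polar

section Abstract

variable {E : Type*} [NormedAddCommGroup E] [InnerProductSpace ℂ E] [CompleteSpace E]

/-- `(1 - C)(1 + C) = 1 + C* C` is strictly positive, and commuting factors of a unit are units. -/
theorem ContinuousLinearMap.isUnit_one_add_of_adjoint_eq_neg {C : E →L[ℂ] E}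
    (hC : C.adjoint = -C) : IsUnit (1 + C) := by
  rw [← ContinuousLinearMap.star_eq_adjoint] at hC
  have h : (1 - C) * (1 + C) = 1 + star C * C := by rw [hC]; noncomm_ring
  have hu : IsUnit ((1 - C) * (1 + C)) := by
    rw [h]
    exact (isStrictlyPositive_one.add_nonneg (star_mul_self_nonneg C)).isUnit
  have hcomm : Commute (1 - C) (1 + C) := by
    rw [commute_iff_eq]
    noncomm_ring
  exact (hcomm.isUnit_mul_iff.mp hu).2

/-- By uniqueness of positive square roots, any positive `P` with `P² = V* V` is `|V|`. -/
theorem IsUnitaryPolarFactor.eq_mul {U V P : E →L[ℂ] E} (hU : IsUnitaryPolarFactor U V)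
    (hP : 0 ≤ P) (h : P * P = star V * V) : V = U * P := by
  rw [← CFC.sqrt_unique h hP]
  exact hU.2

theorem existsUnique_isUnitaryPolarFactor {V : E →L[ℂ] E} (hV : IsUnit V) :
    ∃! U : E →L[ℂ] E, IsUnitaryPolarFactor U V := by
  have hmul := CFC.abs_mul_abs V
  have hsa : star (CFC.abs V) = CFC.abs V := (CFC.abs_nonneg V).isSelfAdjoint
  have hu : IsUnit (CFC.abs V) := by
    have : IsUnit (CFC.abs V * CFC.abs V) := by
      rw [hmul]
      exact hV.star.mul hV
    exact ((Commute.refl _).isUnit_mul_iff.mp this).1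
  obtain ⟨p, hp⟩ := hu
  rw [← hp] at hmul hsa
  have hsi : star (↑p⁻¹ : E →L[ℂ] E) = ↑p⁻¹ := by
    rw [← Units.coe_star_inv, show star p = p from Units.ext hsa]
  -- `|V|` is invertible, so `V |V|⁻¹` is the only candidate.
  refine ⟨V * ↑p⁻¹, ⟨?_, ?_⟩, fun U hU => ?_⟩
  · have hunit : IsUnit (V * ↑p⁻¹) := hV.mul p⁻¹.isUnit
    have h1 : star (V * ↑p⁻¹) * (V * ↑p⁻¹) = 1 := by
      rw [star_mul, hsi, mul_assoc, ← mul_assoc (star V), ← hmul]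
      simp [mul_assoc]
    refine Unitary.mem_iff.mpr ⟨h1, ?_⟩
    obtain ⟨u, hu⟩ := hunit
    rw [← hu] at h1 ⊢
    rw [Units.eq_inv_of_mul_eq_one_right h1, u.mul_inv]
  · rw [← hp, mul_assoc, p.inv_mul, mul_one]
  · have := hU.2
    rw [← hp] at this
    rw [this, mul_assoc, p.mul_inv, mul_one]

end Abstract

variable {H₀ H₁ : Type*}
  [NormedAddCommGroup H₀] [InnerProductSpace ℂ H₀] [CompleteSpace H₀]
  [NormedAddCommGroup H₁] [InnerProductSpace ℂ H₁] [CompleteSpace H₁]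

theorem ContinuousLinearMap.isStrictlyPositive_one_add_adjoint_comp_self (Q : H₀ →L[ℂ] H₁) :
    IsStrictlyPositive (1 + Q.adjoint ∘L Q) := by
  have h : 0 ≤ Q.adjoint ∘L Q :=
    (ContinuousLinearMap.nonneg_iff_isPositive _).mpr Q.isPositive_adjoint_comp_self
  exact isStrictlyPositive_one.add_nonneg h

theorem isUnit_one_add_offDiag (Q : H₀ →L[ℂ] H₁) : IsUnit (1 + offDiag (-Q.adjoint) Q) := by
  refine ContinuousLinearMap.isUnit_one_add_of_adjoint_eq_neg ?_
  rw [adjoint_offDiag, map_neg, ContinuousLinearMap.adjoint_adjoint]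
  refine ContinuousLinearMap.ext fun x => OrthSum.ext_sum ?_ rfl
  exact (neg_neg (Q.adjoint (sumSnd x))).symm

theorem star_mul_self_one_add_offDiag (Q : H₀ →L[ℂ] H₁) :
    star (1 + offDiag (-Q.adjoint) Q) * (1 + offDiag (-Q.adjoint) Q) =
      boundedBlockDiag (1 + Q.adjoint ∘L Q)
        (1 + (-Q.adjoint).adjoint ∘L (-Q.adjoint)) := by
  rw [ContinuousLinearMap.star_eq_adjoint, map_add, adjoint_offDiag,
    ← ContinuousLinearMap.star_eq_adjoint (1 : OrthSum H₀ H₁ →L[ℂ] OrthSum H₀ H₁), star_one,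
    map_neg, ContinuousLinearMap.adjoint_adjoint]
  refine ContinuousLinearMap.ext fun x => OrthSum.ext_sum ?_ ?_
  · change (sumFst x + (-Q.adjoint) (sumSnd x)) + Q.adjoint (sumSnd x + Q (sumFst x)) =
      sumFst x + Q.adjoint (Q (sumFst x))
    rw [map_add, neg_apply]
    abel
  · change (sumSnd x + Q (sumFst x)) + (-Q) (sumFst x + (-Q.adjoint) (sumSnd x)) =
      sumSnd x + (-Q) ((-Q.adjoint) (sumSnd x))
    rw [map_add, neg_apply]
    abel

theorem rpow_half_mul_rpow_half {E F : Type*}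
    [NormedAddCommGroup E] [InnerProductSpace ℂ E] [CompleteSpace E]
    [NormedAddCommGroup F] [InnerProductSpace ℂ F] [CompleteSpace F] (Q : E →L[ℂ] F) :
    (1 + Q.adjoint ∘L Q) ^ (1 / 2 : ℝ) * (1 + Q.adjoint ∘L Q) ^ (1 / 2 : ℝ) =
      1 + Q.adjoint ∘L Q := by
  have h := Q.isStrictlyPositive_one_add_adjoint_comp_self
  rw [← CFC.rpow_add h.isUnit, add_halves, CFC.rpow_one _ h.nonneg]

theorem diagonalizedEntry_domain (A : H₀ →ₗ.[ℂ] H₀) (B : H₁ →L[ℂ] H₀) (Q : H₀ →L[ℂ] H₁) :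
    (diagonalizedEntry A B Q).domain =
      A.domain.map ((1 + Q.adjoint ∘L Q) ^ (1 / 2 : ℝ) : H₀ →L[ℂ] H₀).toLinearMap := by
  have h := Q.isStrictlyPositive_one_add_adjoint_comp_self
  ext x
  constructor
  · intro hx
    exact ⟨_, hx, DFunLike.congr_fun (CFC.rpow_mul_rpow_neg (1 / 2) h) x⟩
  · rintro ⟨y, hy, rfl⟩
    have := DFunLike.congr_fun (CFC.rpow_neg_mul_rpow (1 / 2) h) y
    change ((1 + Q.adjoint ∘L Q) ^ (-(1 / 2) : ℝ) * (1 + Q.adjoint ∘L Q) ^ (1 / 2 : ℝ)) y ∈ A.domain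
    rw [this]
    exact hy

end Polar

theorem theorem4p7 {H₀ H₁ : Type*}
    [NormedAddCommGroup H₀] [InnerProductSpace ℂ H₀] [CompleteSpace H₀]
    [NormedAddCommGroup H₁] [InnerProductSpace ℂ H₁] [CompleteSpace H₁]
    (A₀ : H₀ →ₗ.[ℂ] H₀) (A₁ : H₁ →ₗ.[ℂ] H₁) (hA₀ : IsSelfAdjoint A₀) (hA₁ : IsSelfAdjoint A₁)
    (B₀₁ : H₁ →L[ℂ] H₀) (B₁₀ : H₀ →L[ℂ] H₁) (hB : B₁₀ = B₀₁.adjoint)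
    (H : OrthSum H₀ H₁ →ₗ.[ℂ] OrthSum H₀ H₁)
    (hH : H = addBdd (blockDiag A₀ A₁) (offDiag B₀₁ B₁₀))
    (Q₀₁ : H₁ →L[ℂ] H₀) (Q₁₀ : H₀ →L[ℂ] H₁) (hQ : Q₀₁ = -Q₁₀.adjoint)
    (hG₀ : IsReducingSubspace (graphSubspaceZero Q₁₀) H)
    (hG₁ : IsReducingSubspace (graphSubspaceOne Q₀₁) H)
    (V : OrthSum H₀ H₁ →L[ℂ] OrthSum H₀ H₁) (hV : V = 1 + offDiag Q₀₁ Q₁₀) :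
    -- (i)
    IsUnit V ∧
    -- (ii)
    (addBdd A₀ (B₀₁ ∘L Q₁₀)).domain = A₀.domain ∧
    (addBdd A₁ (B₁₀ ∘L Q₀₁)).domain = A₁.domain ∧
    sandwich (Ring.inverse V) H V =
      blockDiag (addBdd A₀ (B₀₁ ∘L Q₁₀)) (addBdd A₁ (B₁₀ ∘L Q₀₁)) ∧
    -- (iii)
    (∃! U : OrthSum H₀ H₁ →L[ℂ] OrthSum H₀ H₁, IsUnitaryPolarFactor U V) ∧
    (∀ U : OrthSum H₀ H₁ →L[ℂ] OrthSum H₀ H₁, IsUnitaryPolarFactor U V →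
      sandwich U.adjoint H U =
        blockDiag (diagonalizedEntry A₀ B₀₁ Q₁₀) (diagonalizedEntry A₁ B₁₀ Q₀₁)) ∧
    (diagonalizedEntry A₀ B₀₁ Q₁₀).domain =
      A₀.domain.map ((1 + Q₁₀.adjoint ∘L Q₁₀) ^ (1 / 2 : ℝ) : H₀ →L[ℂ] H₀).toLinearMap ∧
    (diagonalizedEntry A₁ B₁₀ Q₀₁).domain =
      A₁.domain.map ((1 + Q₀₁.adjoint ∘L Q₀₁) ^ (1 / 2 : ℝ) : H₁ →L[ℂ] H₁).toLinearMap := by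
  
  have hH' : IsSelfAdjoint (addBdd (blockDiag A₀ A₁) (offDiag B₀₁ B₁₀)) := by
    refine (hA₀.blockDiag hA₁).addBdd ?_
    rw [adjoint_offDiag, hB, ContinuousLinearMap.adjoint_adjoint]
  subst hH hQ hV
  have hunit := isUnit_one_add_offDiag Q₁₀
  have hconj := sandwich_inverse_eq_blockDiag hunit
    (T₀ := addBdd A₀ (B₀₁ ∘L Q₁₀)) (T₁ := addBdd A₁ (B₁₀ ∘L (-Q₁₀.adjoint)))
    (one_add_offDiag_mem_domain_iff hA₀ hA₁ hH' hG₀ hG₁ hunit)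
    (addBdd_blockDiag_one_add_offDiag_apply hA₀ hA₁ hH' hG₀ hG₁)
  refine ⟨hunit, rfl, rfl, hconj, existsUnique_isUnitaryPolarFactor hunit, fun U hU => ?_,
    diagonalizedEntry_domain _ _ _, diagonalizedEntry_domain _ _ _⟩
  set V := 1 + offDiag (-Q₁₀.adjoint) Q₁₀ with hVdef
  have h₀ := Q₁₀.isStrictlyPositive_one_add_adjoint_comp_self
  have h₁ := (-Q₁₀.adjoint).isStrictlyPositive_one_add_adjoint_comp_self
  let P := boundedBlockDiag ((1 + Q₁₀.adjoint ∘L Q₁₀) ^ (1 / 2 : ℝ))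
    ((1 + (-Q₁₀.adjoint).adjoint ∘L (-Q₁₀.adjoint)) ^ (1 / 2 : ℝ))
  let R := boundedBlockDiag ((1 + Q₁₀.adjoint ∘L Q₁₀) ^ (-(1 / 2) : ℝ))
    ((1 + (-Q₁₀.adjoint).adjoint ∘L (-Q₁₀.adjoint)) ^ (-(1 / 2) : ℝ))
  -- `P` is `|V|`, since its square is `V* V`; `R` is its inverse.
  have hP : V = U * P := by
    refine hU.eq_mul (boundedBlockDiag_nonneg CFC.rpow_nonneg CFC.rpow_nonneg) ?_
    rw [boundedBlockDiag_mul, rpow_half_mul_rpow_half, rpow_half_mul_rpow_half, hVdef,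
      star_mul_self_one_add_offDiag]
  have hPR : P * R = 1 := by
    rw [boundedBlockDiag_mul, CFC.rpow_mul_rpow_neg _ h₀, CFC.rpow_mul_rpow_neg _ h₁,
      boundedBlockDiag_one]
  have hUV : U = V * R := by rw [hP, mul_assoc, hPR, mul_one]
  have hUs : U.adjoint = P * Ring.inverse V := by
    rw [← mul_one U.adjoint, ← Ring.mul_inverse_cancel V hunit, ← mul_assoc]
    congr 1
    rw [hP, ← mul_assoc, ← ContinuousLinearMap.star_eq_adjoint, Unitary.star_mul_self_of_mem hU.1,
      one_mul]
  rw [hUs, hUV]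
  -- `(P V⁻¹) H (V R)` and `P (V⁻¹ H V) R` agree definitionally, natural domains included.
  exact (congrArg (fun T => sandwich P T R) hconj).trans (sandwich_boundedBlockDiag _ _ _ _ _ _)
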